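/- Let $\mathbb A$ be a finite alphabet. For a finite nonempty word $w$ over $\mathbb A$, a border of $w$ is a nonempty word, strictly shorter than $w$, that is both a prefix and a suffix of $w$; the word $w$ is called closed if it is a single letter or if it has a border which occurs in $w$ exactly twice. For an infinite word $x=x_1x_2x_3\cdots\in\mathbb A^{\mathbb N}$, a factor of $x$ is a nonempty finite word of the form $x_mx_{m+1}\cdots x_{m+n-1}$, and $\mathrm{cl}_x(n)$ denotes the number of distinct closed factors of $x$ of length $n$. A set $S\subseteq\mathbb N$ is syndetic if there is a positive integer $d$ such that $S\cap\{n,n+1,\dots,n+d\}\neq\emptyset$ for every $n\in\mathbb N$. **Theorem.** Let $x\in\mathbb A^{\mathbb N}$ be an infinite word over a finite alphabet $\mathbb A$, and suppose that there exist a syndetic set $S\subseteq\mathbb N$ and $k\in\mathbb N$ such that $\mathrm{cl}_x(n)<k$ for every $n\in S$. Then $x$ is ultimately periodic, that is, $x=uvvv\cdots$ for some nonempty finite words $u,v$ over $\mathbb A$. -/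

import Mathlib

/-! Finite words over `A` are terms of `List A`, and right-infinite words are terms of Mathlib's
`Stream' A`, that is, sequences `ℕ → A`. -/

namespace InfiniteWord

variable {A : Type*}

/-- The set of positions at which the word `v` occurs in the finite word `w`
(used for nonempty `v` only). -/
def occurrences (v w : List A) : Set ℕ :=
  {m | v <+: w.drop m}

/-- `v` is a border of `w`: a nonempty word, shorter than `w`, which is both a prefix and a suffix
of `w`. -/
def IsBorder (v w : List A) : Prop :=
  v ≠ [] ∧ v.length < w.length ∧ v <+: w ∧ v <:+ w

/-- A finite word is closed if it is a letter, or if it has a border which occurs in it precisely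
twice. The empty word is not closed. -/
def IsClosedWord (w : List A) : Prop :=
  w.length = 1 ∨ ∃ v : List A, IsBorder v w ∧ (occurrences v w).ncard = 2

/-- The nonempty word `w` is a factor of the infinite word `x`: it occurs in `x` at some
position `m`. -/
def IsFactor (w : List A) (x : Stream' A) : Prop :=
  w ≠ [] ∧ ∃ m : ℕ, (x.drop m).take w.length = w

/-- The set of closed factors of length `n` of the infinite word `x`. -/
def closedFactors (x : Stream' A) (n : ℕ) : Set (List A) :=
  {w | IsFactor w x ∧ w.length = n ∧ IsClosedWord w}

/-- Over a finite alphabet, there are finitely many closed factors of each length. -/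
theorem finite_closedFactors [Finite A] (x : Stream' A) (n : ℕ) : (closedFactors x n).Finite :=
  (List.finite_length_eq A n).subset fun _ hw => hw.2.1

/-- The closed complexity of `x`: the number of closed factors of `x` of length `n`. -/
noncomputable def closedComplexity (x : Stream' A) (n : ℕ) : ℕ :=
  (closedFactors x n).ncard

/-- `S` is syndetic: for some positive integer `d`, it meets every interval `{n, …, n + d}`. -/
def IsSyndetic (S : Set ℕ) : Prop :=
  ∃ d : ℕ, 0 < d ∧ ∀ n : ℕ, (S ∩ Set.Icc n (n + d)).Nonempty

/-- `x` is ultimately periodic: `x = u v v v …` for some nonempty finite words `u` and `v`. -/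
def IsUltimatelyPeriodic (x : Stream' A) : Prop :=
  ∃ (u v : List A) (hv : v ≠ []), u ≠ [] ∧ x = u ++ₛ Stream'.cycle v hv

end InfiniteWord

namespace InfiniteWord

/-! Put `D = k + d`. In a deep return the repeated word can be widened on both sides. Sliding the
widened border by `s < k` gives `k` distinct closed factors of one length, and letting the widening
run over `[k, D]` makes these lengths fill an interval that meets `S`. So `x` has no deep return
from position `D` on (`not_isDeepReturn_of_syndetic`).

If `x` were not ultimately periodic, markers would appear arbitrarily far out, and a marker forces
returns longer than `D`. Without deep returns, the limit points of the shifts of `x` form a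
splitting subshift (`isSplitting_limitSet`). Suppose none of its words has a deep return, and take a
minimal splitting subshift inside it, by Zorn. It contains a word `y` with infinitely many markers,
whose limit points in a direction with infinitely many markers again form a splitting subshift. By
minimality `y` is among them, so it is recurrent; but a recurrent word with a marker has a deep
return (`exists_isDeepReturn_of_recurrent`). Hence some limit point of `x` has a deep return, which
reappears far out in `x`: a contradiction. -/

/-- The window `[c, c + 2D]` of the two-sided word `y` has no period `p` with `0 < p ≤ D`. -/
def IsMarker {A : Type*} (D : ℤ) (y : ℤ → A) (c : ℤ) : Prop :=
  ∀ p, 0 < p → p ≤ D → ∃ t, c ≤ t ∧ t + p ≤ c + 2 * D ∧ y (t + p) ≠ y t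

/-- The word `y[i, j)` occurs at `i` and next at `i + n`, where `n > D`, and the two occurrences
have the same extension by `D` letters to the left and to the right. -/
structure IsDeepReturn {A : Type*} (D : ℤ) (y : ℤ → A) (i j n : ℤ) : Prop where
  lt_return : D < n
  lt : i < j
  eq_add : ∀ t, i - D ≤ t → t < j + D → y (t + n) = y t
  first : ∀ m, 0 < m → m < n → ∃ t, i ≤ t ∧ t < j ∧ y (t + m) ≠ y t

/-! ### Markers and local periods -/

section Markers

variable {A : Type*} {D : ℤ} {y z : ℤ → A}

theorem IsMarker.congr_shift {c m : ℤ} (h : IsMarker D y c)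
    (hyz : ∀ t, c ≤ t → t ≤ c + 2 * D → z (t + m) = y t) : IsMarker D z (c + m) := by
  intro p hp hpD
  obtain ⟨t, ht, htp, hne⟩ := h p hp hpD
  refine ⟨t + m, by omega, by omega, ?_⟩
  rw [hyz t ht (by omega), show t + m + p = t + p + m by ring, hyz (t + p) (by omega) htp]
  exact hne

theorem IsMarker.congr {c : ℤ} (h : IsMarker D y c)
    (hyz : ∀ t, c ≤ t → t ≤ c + 2 * D → z t = y t) : IsMarker D z c := by
  simpa using h.congr_shift (m := 0) (by simpa using hyz)

/-- A return by `n ≤ D` would be a short period of the window. -/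
theorem IsMarker.lt_return {c n : ℤ} (h : IsMarker D y c) (hn : 0 < n)
    (hr : ∀ t, c ≤ t → t ≤ c + 2 * D → y (t + n) = y t) : D < n := by
  by_contra! hnD
  obtain ⟨t, ht, htn, hne⟩ := h n hn hnD
  exact hne (hr t ht (by omega))

theorem not_isMarker {c : ℤ} (h : ¬ IsMarker D y c) :
    ∃ p, 0 < p ∧ p ≤ D ∧ ∀ t, c ≤ t → t + p ≤ c + 2 * D → y (t + p) = y t := by
  unfold IsMarker at h
  push Not at h
  exact h

/-- Two words without markers in a window which agree up to the last letter agree there too. -/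
theorem eq_right_of_not_isMarker {c : ℤ} (hy : ¬ IsMarker D y c) (hz : ¬ IsMarker D z c)
    (h : ∀ t, c ≤ t → t < c + 2 * D → z t = y t) : z (c + 2 * D) = y (c + 2 * D) := by
  obtain ⟨p, hp, hpD, hy⟩ := not_isMarker hy
  obtain ⟨q, hq, hqD, hz⟩ := not_isMarker hz
  -- As `p + q ≤ 2 * D`, position `c + 2 * D - p - q` is still in the window: both last letters
  -- equal the letter there, reached by the two periods in either order.
  have h1 := hy (c + 2 * D - p) (by omega) (by omega)
  have h2 := hz (c + 2 * D - q) (by omega) (by omega)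
  have h3 := hz (c + 2 * D - p - q) (by omega) (by omega)
  have h4 := hy (c + 2 * D - q - p) (by omega) (by omega)
  have h5 := h (c + 2 * D - p) (by omega) (by omega)
  have h6 := h (c + 2 * D - q) (by omega) (by omega)
  have h7 := h (c + 2 * D - p - q) (by omega) (by omega)
  simp only [sub_add_cancel] at h1 h2 h3 h4
  rw [show c + 2 * D - q - p = c + 2 * D - p - q by ring] at h4
  rw [h1, h2, h6, h4, ← h7, ← h3, h5]

theorem eq_left_of_not_isMarker {c : ℤ} (hy : ¬ IsMarker D y c) (hz : ¬ IsMarker D z c)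
    (h : ∀ t, c < t → t ≤ c + 2 * D → z t = y t) : z c = y c := by
  obtain ⟨p, hp, hpD, hy⟩ := not_isMarker hy
  obtain ⟨q, hq, hqD, hz⟩ := not_isMarker hz
  have h1 := hy c (by omega) (by omega)
  have h2 := hz c (by omega) (by omega)
  have h3 := hz (c + p) (by omega) (by omega)
  have h4 := hy (c + q) (by omega) (by omega)
  have h5 := h (c + p) (by omega) (by omega)
  have h6 := h (c + q) (by omega) (by omega)
  have h7 := h (c + p + q) (by omega) (by omega)
  rw [show c + q + p = c + p + q by ring] at h4
  rw [← h1, ← h2, h6, ← h4, ← h7, h3, h5]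

/-- A word is determined by a window outside of which there are no markers. -/
theorem eq_of_not_isMarker {a b : ℤ} (hD : 0 < D) (hab : a + 2 * D ≤ b)
    (hy : ∀ c, (c < a ∨ b ≤ c + 2 * D) → ¬ IsMarker D y c)
    (hz : ∀ c, (c < a ∨ b ≤ c + 2 * D) → ¬ IsMarker D z c)
    (h : ∀ t, a ≤ t → t < b → z t = y t) : z = y := by
  have key : ∀ n : ℕ, ∀ t, a - n ≤ t → t < b + n → z t = y t := by
    intro n
    induction n with
    | zero => simpa using h
    | succ n ih =>
      intro t h1 h2
      push_cast at h1 h2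
      rcases lt_or_ge t (a - n) with h3 | h3
      · exact eq_left_of_not_isMarker (hy t (by omega)) (hz t (by omega))
          fun s _ _ => ih s (by omega) (by omega)
      rcases lt_or_ge t (b + n) with h4 | h4
      · exact ih t h3 h4
      · have := eq_right_of_not_isMarker (c := t - 2 * D) (hy _ (by omega)) (hz _ (by omega))
          fun s _ _ => ih s (by omega) (by omega)
        simpa using this
  funext t
  refine key ((t - a).natAbs + (t - b).natAbs + 1) t (by omega) (by omega)

/-- A word with finitely many markers to the right is eventually periodic. -/
theorem exists_period_of_not_isMarker {T : ℤ} (h : ∀ c, T ≤ c → ¬ IsMarker D y c) :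
    ∃ p, 0 < p ∧ ∀ t, T ≤ t → y (t + p) = y t := by
  obtain ⟨p, hp, hpD, hy⟩ := not_isMarker (h T le_rfl)
  refine ⟨p, hp, ?_⟩
  have key : ∀ n : ℕ, ∀ t, T ≤ t → t + p ≤ T + 2 * D + n → y (t + p) = y t := by
    intro n
    induction n with
    | zero => simpa using hy
    | succ n ih =>
      intro t h1 h2
      push_cast at h2
      rcases lt_or_ge (T + 2 * D + n) (t + p) with h3 | h3
      -- The window starting at `T + n + 1` ends exactly at the new letter `t + p`; its period `q`
      -- carries the claim back to `t - q`.
      · obtain ⟨q, hq, hqD, hyq⟩ := not_isMarker (h (T + n + 1) (by omega))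
        have e1 := hyq (t + p - q) (by omega) (by omega)
        have e2 := hyq (t - q) (by omega) (by omega)
        have e3 := ih (t - q) (by omega) (by omega)
        rw [show t - q + p = t + p - q by ring] at e3
        simp only [sub_add_cancel] at e1 e2
        rw [e1, e3, e2]
      · exact ih t h1 h3
  intro t ht
  exact key (t + p - T - 2 * D).natAbs t ht (by omega)

end Markers

/-! ### Deep returns produce many closed factors -/

section ClosedWords

variable {A : Type*}

theorem isClosedWord_of_first_return {w : List A} {b n : ℕ} (hb : 0 < b) (hn : 0 < n)
    (hw : w.length = b + n) (hr : ∀ q < b, w[q + n]? = w[q]?)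
    (hf : ∀ m, 0 < m → m < n → ∃ q < b, w[q + m]? ≠ w[q]?) : IsClosedWord w := by
  have hocc : ∀ m, w.take b <+: w.drop m ↔ ∀ q < b, w[q + m]? = w[q]? := by
    intro m
    rw [List.prefix_iff_getElem?]
    constructor
    · intro h q hq
      have := h q (by simp; omega)
      rw [List.getElem?_drop, add_comm m q] at this
      rw [this, List.getElem_take, List.getElem?_eq_getElem]
    · intro h q hq
      have hq' : q < b := by simp at hq; omega
      rw [List.getElem?_drop, add_comm m q, h q hq', List.getElem_take, List.getElem?_eq_getElem]
  have hset : occurrences (w.take b) w = {0, n} := by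
    ext m
    change w.take b <+: w.drop m ↔ m ∈ ({0, n} : Set ℕ)
    rw [hocc]
    constructor
    · intro h
      rcases Nat.eq_zero_or_pos m with rfl | hm
      · simp
      rcases lt_trichotomy m n with h1 | rfl | h1
      · obtain ⟨q, hq, hne⟩ := hf m hm h1
        exact absurd (h q hq) hne
      · simp
      -- For `m > n` the last letter of the border would fall beyond the end of `w`.
      · have := h (b - 1) (by omega)
        rw [List.getElem?_eq_none (by omega), eq_comm, List.getElem?_eq_none_iff] at this
        omega
    · rintro (rfl | rfl)
      · simp
      · exact hr
  refine Or.inr ⟨w.take b, ⟨?_, ?_, List.take_prefix _ _, ?_⟩, ?_⟩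
  · intro h
    have := congrArg List.length h
    rw [List.length_take, List.length_nil] at this
    omega
  · rw [List.length_take]; omega
  · have h1 : w.take b <+: w.drop n := (hocc n).2 hr
    have h2 := h1.eq_of_length (by simp; omega)
    rw [h2]
    exact List.drop_suffix _ _
  · rw [hset, Set.ncard_pair (by omega)]

/-- The two-sided word which extends `x` to the left by a constant word. -/
def twoSided (x : Stream' A) : ℤ → A := fun t => x.get t.toNat

theorem getElem?_take_drop (x : Stream' A) {a l q : ℕ} (hq : q < l) :
    ((x.drop a).take l)[q]? = some (twoSided x (a + q : ℕ)) := by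
  rw [Stream'.getElem?_take hq, Stream'.get_drop, twoSided, Int.toNat_natCast, add_comm]

/-- The factors start at `i - s` for `s < k`, with border of length `j - i + e`. This border
contains `y[i, j)` because `s < e`, so it cannot return before `n`; it stays within the common
extension because `e ≤ D`. -/
theorem le_closedComplexity_of_isDeepReturn [Finite A] {x : Stream' A} {D i j n : ℤ} {k e : ℕ}
    (hi : D ≤ i) (h : IsDeepReturn D (twoSided x) i j n) (hke : k ≤ e) (heD : e ≤ D) :
    k ≤ closedComplexity x (j - i + n + e).toNat := by
  obtain ⟨hDn, hij, heq, hfirst⟩ := h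
  set y := twoSided x with hy
  set N := (j - i + n + e).toNat with hN
  let w : ℕ → List A := fun s => (x.drop (i - s).toNat).take N
  have hget : ∀ s < k, ∀ q < N, (w s)[q]? = some (y (i - s + q)) := by
    intro s hs q hq
    rw [getElem?_take_drop x hq, ← hy]
    congr 2
    push_cast
    omega
  have hlen : ∀ s, (w s).length = N := fun s => Stream'.length_take _ _
  have hmem : ∀ s < k, w s ∈ closedFactors x N := by
    intro s hs
    refine ⟨⟨?_, (i - s).toNat, ?_⟩, hlen s, ?_⟩
    · intro h0
      have := hlen s
      rw [h0] at this
      simp at this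
      omega
    · rw [hlen]
    · refine isClosedWord_of_first_return (b := (j - i + e).toNat) (n := n.toNat) (by omega)
        (by omega) (by rw [hlen]; omega) ?_ ?_
      · intro q hq
        rw [hget s hs _ (by omega), hget s hs _ (by omega)]
        have := heq (i - s + q) (by omega) (by omega)
        rw [← this]
        congr 2
        push_cast
        omega
      · intro m hm hmn
        obtain ⟨t, ht, htj, hne⟩ := hfirst m (by omega) (by omega)
        refine ⟨(t - (i - s)).toNat, by omega, ?_⟩
        rw [hget s hs _ (by omega), hget s hs _ (by omega)]
        intro hc
        apply hne
        have := Option.some.inj hc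
        convert this using 2 <;> omega
  have hinj : Set.InjOn w (Set.Iio k) := by
    have aux : ∀ s s', s < s' → s' < k → w s ≠ w s' := by
      intro s s' hss hs' hc
      -- Equal factors would make `y[i, j)` return after `s' - s < k ≤ D < n`.
      obtain ⟨t, ht, htj, hne⟩ := hfirst (s' - s) (by omega) (by omega)
      have h1 := hget s (by omega) (t - (i - s')).toNat (by omega)
      have h2 := hget s' hs' (t - (i - s')).toNat (by omega)
      rw [hc, h2] at h1
      apply hne
      have := Option.some.inj h1
      rw [eq_comm]
      convert this using 2 <;> omega
    intro s hs s' hs' hc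
    rcases lt_trichotomy s s' with h1 | h1 | h1
    · exact absurd hc (aux s s' h1 hs')
    · exact h1
    · exact absurd hc.symm (aux s' s h1 hs)
  calc k = (Set.Iio k).ncard := by simp
    _ = (w '' Set.Iio k).ncard := hinj.ncard_image.symm
    _ ≤ closedComplexity x N := Set.ncard_le_ncard (by rintro _ ⟨s, hs, rfl⟩; exact hmem s hs)
        (finite_closedFactors x N)

theorem not_isDeepReturn_of_syndetic [Finite A] {x : Stream' A} {S : Set ℕ} {k d : ℕ}
    (hS : ∀ n : ℕ, (S ∩ Set.Icc n (n + d)).Nonempty) (hk : ∀ n ∈ S, closedComplexity x n < k)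
    {i j n : ℤ} (hi : (k + d : ℕ) ≤ i) : ¬ IsDeepReturn (k + d : ℕ) (twoSided x) i j n := by
  intro h
  obtain ⟨N, hNS, h1, h2⟩ := hS (j - i + n + k).toNat
  have h3 := h.lt
  have h4 := h.lt_return
  have := le_closedComplexity_of_isDeepReturn (k := k) (e := (N - (j - i + n)).toNat) hi h
    (by omega) (by omega)
  have h5 := hk N hNS
  rw [show (j - i + n + ((N - (j - i + n)).toNat : ℕ)).toNat = N by omega] at this
  omega

end ClosedWords

/-! ### Ultimate periodicity -/

section Periodicity

variable {A : Type*}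

theorem eq_of_eq_append {v : List A} (hv : v ≠ []) {s s' : Stream' A} (hs : s = v ++ₛ s)
    (hs' : s' = v ++ₛ s') : s = s' := by
  have hpos := List.length_pos_iff.2 hv
  refine Stream'.ext fun n => ?_
  induction n using Nat.strong_induction_on with
  | _ n ih =>
    rw [hs, hs']
    rcases lt_or_ge n v.length with h | h
    · rw [Stream'.get_append_left _ _ _ h, Stream'.get_append_left _ _ _ h]
    · obtain ⟨m, rfl⟩ := Nat.exists_eq_add_of_le h
      rw [Stream'.get_append_right, Stream'.get_append_right]
      exact ih m (by omega)

theorem isUltimatelyPeriodic_of_period {x : Stream' A} {T p : ℕ} (hp : 0 < p)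
    (h : ∀ t, T ≤ t → x.get (t + p) = x.get t) : IsUltimatelyPeriodic x := by
  have hv : (x.drop (T + 1)).take p ≠ [] := by
    intro h0
    have := congrArg List.length h0
    rw [Stream'.length_take] at this
    simp at this
    omega
  -- `T + 1` rather than `T`, since the preperiod must be nonempty.
  refine ⟨x.take (T + 1), (x.drop (T + 1)).take p, hv, by simp [Stream'.take_succ], ?_⟩
  rw [← eq_of_eq_append hv (s := x.drop (T + 1)) ?_ (Stream'.cycle_eq _ hv),
    Stream'.append_take_drop]
  have : (x.drop (T + 1)).drop p = x.drop (T + 1) := by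
    refine Stream'.ext fun n => ?_
    simp only [Stream'.get_drop]
    rw [show T + 1 + (p + n) = (T + 1 + n) + p by omega]
    exact h _ (by omega)
  conv_rhs => rw [← this]
  rw [this]
  conv_lhs => rw [← Stream'.append_take_drop p (x.drop (T + 1)), this]

theorem exists_isMarker_of_not_isUltimatelyPeriodic {x : Stream' A}
    (hx : ¬ IsUltimatelyPeriodic x) (D T : ℤ) : ∃ c, T ≤ c ∧ IsMarker D (twoSided x) c := by
  by_contra! h
  obtain ⟨p, hp, hper⟩ := exists_period_of_not_isMarker h
  refine hx (isUltimatelyPeriodic_of_period (T := T.toNat) (p := p.toNat) (by omega) ?_)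
  intro t ht
  have := hper t (by omega)
  simp only [twoSided] at this
  rwa [show ((t : ℤ) + p).toNat = t + p.toNat by omega, Int.toNat_natCast] at this

end Periodicity

/-! ### Deep returns in recurrent words -/

section Recurrence

variable {A : Type*} {D : ℤ}

theorem exists_first_return {y : ℤ → A} {i j m : ℤ} (hm : 0 < m)
    (hr : ∀ t, i ≤ t → t < j → y (t + m) = y t) :
    ∃ n, 0 < n ∧ n ≤ m ∧ (∀ t, i ≤ t → t < j → y (t + n) = y t) ∧
      ∀ l, 0 < l → l < n → ∃ t, i ≤ t ∧ t < j ∧ y (t + l) ≠ y t := by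
  classical
  have hex : ∃ n : ℕ, 0 < n ∧ ∀ t, i ≤ t → t < j → y (t + n) = y t :=
    ⟨m.toNat, by omega, by rwa [Int.toNat_of_nonneg hm.le]⟩
  refine ⟨Nat.find hex, by exact_mod_cast (Nat.find_spec hex).1, ?_, (Nat.find_spec hex).2, ?_⟩
  · have : Nat.find hex ≤ m.toNat :=
      Nat.find_min' hex ⟨by omega, by rwa [Int.toNat_of_nonneg hm.le]⟩
    omega
  · intro l hl hln
    have := Nat.find_min hex (m := l.toNat) (by omega)
    rw [not_and, Int.toNat_of_nonneg hl.le] at this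
    have := this (by omega)
    push Not at this
    exact this

/-- The words which follow an occurrence of `y[i, j)` in `y`. -/
def rightExt (l : ℕ) (y : ℤ → A) (i j : ℤ) : Set (Fin l → A) :=
  {β | ∃ n, (∀ t, i ≤ t → t < j → y (t + n) = y t) ∧ ∀ s : Fin l, β s = y (j + n + (s : ℕ))}

/-- The reversals of the words which precede an occurrence of `y[i, j)` in `y`. -/
def leftExt (l : ℕ) (y : ℤ → A) (i j : ℤ) : Set (Fin l → A) :=
  {α | ∃ n, (∀ t, i ≤ t → t < j → y (t + n) = y t) ∧
    ∀ s : Fin l, α s = y (i + n - 1 - (s : ℕ))}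

/-- Each occurrence of a longer word ends with an occurrence of its suffix, so lengthening to the
left can only lose right extensions. -/
theorem rightExt_subset {l : ℕ} {y : ℤ → A} {i j i' j' m : ℤ}
    (hm : ∀ t, i ≤ t → t < j → y (t + m) = y t) (hi : i' ≤ i + m) (hj : j' = j + m) :
    rightExt l y i' j' ⊆ rightExt l y i j := by
  rintro β ⟨n, hn, hβ⟩
  refine ⟨m + n, fun t ht htj => ?_, fun s => ?_⟩
  · rw [← add_assoc, hn _ (by omega) (by omega), hm t ht htj]
  · rw [hβ, hj, add_assoc j]

theorem leftExt_subset {l : ℕ} {y : ℤ → A} {i j i' j' m : ℤ}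
    (hm : ∀ t, i ≤ t → t < j → y (t + m) = y t) (hi : i' = i + m) (hj : j + m ≤ j') :
    leftExt l y i' j' ⊆ leftExt l y i j := by
  rintro β ⟨n, hn, hβ⟩
  refine ⟨m + n, fun t ht htj => ?_, fun s => ?_⟩
  · rw [← add_assoc, hn _ (by omega) (by omega), hm t ht htj]
  · rw [hβ, hi, add_assoc i]

/-- The word `y[i, j)` contains a marker. -/
def HasMarker (D : ℤ) (y : ℤ → A) (i j : ℤ) : Prop :=
  ∃ c, i ≤ c ∧ c + 2 * D < j ∧ IsMarker D y c

theorem HasMarker.of_occurrence {y : ℤ → A} {i j i' j' m : ℤ} (h : HasMarker D y i j)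
    (hm : ∀ t, i ≤ t → t < j → y (t + m) = y t) (hi : i' ≤ i + m) (hj : j + m ≤ j') :
    HasMarker D y i' j' := by
  obtain ⟨c, hc, hcj, hM⟩ := h
  exact ⟨c + m, by omega, by omega,
    hM.congr_shift fun t _ _ => hm t (by omega) (by omega)⟩

theorem exists_ncard_minimal {B : Type*} {P : ℤ → ℤ → Prop} (f : ℤ → ℤ → Set B)
    (h : ∃ i j, P i j) : ∃ i j, P i j ∧ ∀ i' j', P i' j' → (f i j).ncard ≤ (f i' j').ncard := by
  classical
  have hex : ∃ r : ℕ, ∃ i j, P i j ∧ (f i j).ncard = r := by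
    obtain ⟨i, j, hP⟩ := h
    exact ⟨_, i, j, hP, rfl⟩
  obtain ⟨i, j, hP, hr⟩ := Nat.find_spec hex
  exact ⟨i, j, hP, fun i' j' h' => hr ▸ Nat.find_min' hex ⟨i', j', h', rfl⟩⟩

/-- A recurrent word with a marker has a deep return: a first return to a word whose sets of left
and right extensions are of minimal size. -/
theorem exists_isDeepReturn_of_recurrent [Finite A] {l : ℕ} {y : ℤ → A}
    (hrec : ∀ i j i' j' B : ℤ, ∃ m m', m' + B ≤ m ∧ (∀ t, i ≤ t → t < j → y (t + m) = y t) ∧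
      ∀ t, i' ≤ t → t < j' → y (t + m') = y t)
    (hM : ∃ c, IsMarker l y c) : ∃ i j n, IsDeepReturn l y i j n := by
  have hex : ∃ i j, HasMarker l y i j := by
    obtain ⟨c, hc⟩ := hM
    exact ⟨c, c + 2 * l + 1, c, by omega, by omega, hc⟩
  obtain ⟨i₀, j₀, hM₀, hmin₀⟩ := exists_ncard_minimal (rightExt l y) hex
  obtain ⟨i₁, j₁, hM₁, hmin₁⟩ := exists_ncard_minimal (leftExt l y) hex
  -- By minimality, lengthening `y[i₀, j₀)` to the left loses no right extension; symmetrically for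
  -- `hL`.
  have hR : ∀ i j m, (∀ t, i₀ ≤ t → t < j₀ → y (t + m) = y t) → i ≤ i₀ + m → j = j₀ + m →
      rightExt l y i j = rightExt l y i₀ j₀ := fun i j m hm hi hj =>
    Set.eq_of_subset_of_ncard_le (rightExt_subset hm hi hj)
      (hmin₀ _ _ (hM₀.of_occurrence hm hi hj.ge)) (Set.toFinite _)
  have hL : ∀ i j m, (∀ t, i₁ ≤ t → t < j₁ → y (t + m) = y t) → i = i₁ + m → j₁ + m ≤ j →
      leftExt l y i j = leftExt l y i₁ j₁ := fun i j m hm hi hj =>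
    Set.eq_of_subset_of_ncard_le (leftExt_subset hm hi hj)
      (hmin₁ _ _ (hM₁.of_occurrence hm hi.le hj)) (Set.toFinite _)
  obtain ⟨m₀, m₁, hmm, hm₀, hm₁⟩ := hrec i₀ j₀ i₁ j₁ (|i₁ - i₀| + |j₁ - j₀|)
  have hi₁ := le_abs_self (i₁ - i₀)
  have hj₁ := le_abs_self (j₁ - j₀)
  have hi₁' := abs_nonneg (i₁ - i₀)
  have hj₁' := abs_nonneg (j₁ - j₀)
  obtain ⟨i, hi⟩ : ∃ i, i = i₁ + m₁ := ⟨_, rfl⟩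
  obtain ⟨j, hj⟩ : ∃ j, j = j₀ + m₀ := ⟨_, rfl⟩
  have hij : i < j := by
    obtain ⟨c, hc, hcj, -⟩ := hM₀
    omega
  -- the word `y[i, j)` begins with `y[i₁, j₁)` and ends with `y[i₀, j₀)`
  obtain ⟨a', a, haa, ha', ha⟩ := hrec i j i j 1
  obtain ⟨n, hn, -, hret, hfirst⟩ := exists_first_return (y := y) (i := i + a) (j := j + a)
    (m := a' - a) (by omega) fun t ht htj => by
      have h1 := ha' (t - a) (by omega) (by omega)
      have h2 := ha (t - a) (by omega) (by omega)
      rw [sub_add_cancel] at h2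
      rw [show t + (a' - a) = t - a + a' by ring, h1, h2]
  have hocc₀ : ∀ t, i₀ ≤ t → t < j₀ → y (t + (m₀ + a)) = y t := fun t ht htj => by
    rw [← add_assoc, ha _ (by omega) (by omega), hm₀ t ht htj]
  have hocc₁ : ∀ t, i₁ ≤ t → t < j₁ → y (t + (m₁ + a)) = y t := fun t ht htj => by
    rw [← add_assoc, ha _ (by omega) (by omega), hm₁ t ht htj]
  have hocc₀' : ∀ t, i₀ ≤ t → t < j₀ → y (t + (m₀ + a + n)) = y t := fun t ht htj => by
    rw [← add_assoc, hret _ (by omega) (by omega), hocc₀ t ht htj]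
  have hocc₁' : ∀ t, i₁ ≤ t → t < j₁ → y (t + (m₁ + a + n)) = y t := fun t ht htj => by
    rw [← add_assoc, hret _ (by omega) (by omega), hocc₁ t ht htj]
  have hln : (l : ℤ) < n := by
    obtain ⟨c, hc, hcj, hMc⟩ := hM₀.of_occurrence hocc₀ (i' := i + a) (j' := j + a)
      (by omega) (by omega)
    exact hMc.lt_return hn fun t _ _ => hret t (by omega) (by omega)
  -- The complete return word has the same right extensions as `y[i + a, j + a)`, so some occurrence
  -- of it is followed by what follows its first copy.
  obtain ⟨b, hb, hβ⟩ : (fun s : Fin l => y (j + a + (s : ℕ))) ∈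
      rightExt l y (i + a) (j + a + n) := by
    rw [hR _ _ (m₀ + a + n) hocc₀' (by omega) (by omega),
      ← hR (i + a) (j + a) (m₀ + a) hocc₀ (by omega) (by omega)]
    exact ⟨0, by simp, by simp⟩
  have hocc₁b : ∀ t, i₁ ≤ t → t < j₁ → y (t + (m₁ + a + b)) = y t := fun t ht htj => by
    rw [← add_assoc, hb _ (by omega) (by omega), hocc₁ t ht htj]
  -- Likewise, some occurrence of this lengthened word is preceded by what precedes the second copy.
  -- There both copies have equal extensions; the inner ones lie inside the return word because `l <
  -- n`.
  obtain ⟨e, he, hα⟩ : (fun s : Fin l => y (i + a + n - 1 - (s : ℕ))) ∈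
      leftExt l y (i + a + b) (j + a + n + b + l) := by
    rw [hL _ _ (m₁ + a + b) hocc₁b (by omega) (by omega),
      ← hL (i + a + n) (j + a + n) (m₁ + a + n) hocc₁' (by omega) (by omega)]
    exact ⟨0, by simp, by simp⟩
  have hcopy : ∀ t, i + a ≤ t → t < j + a + n → y (t + (b + e)) = y t := fun t ht htj => by
    rw [← add_assoc, he _ (by omega) (by omega), hb t ht htj]
  refine ⟨i + a + b + e, j + a + b + e, n, hln, by omega, ?_, ?_⟩
  · intro t ht htj
    rcases lt_or_ge t (i + a + b + e) with h1 | h1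
    · have h2 := hα ⟨(i + a + b + e - 1 - t).toNat, by omega⟩
      simp only at h2
      rw [show i + a + b + e - 1 - ((i + a + b + e - 1 - t).toNat : ℕ) = t by omega,
        show i + a + n - 1 - ((i + a + b + e - 1 - t).toNat : ℕ) = t + n - (b + e) by omega] at h2
      have h4 := hcopy (t + n - (b + e)) (by omega) (by omega)
      rw [sub_add_cancel] at h4
      rw [h4, h2]
    rcases lt_or_ge t (j + a + b + e) with h3 | h3
    · have h4 := hcopy (t - (b + e)) (by omega) (by omega)
      have h5 := hcopy (t - (b + e) + n) (by omega) (by omega)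
      have h6 := hret (t - (b + e)) (by omega) (by omega)
      rw [sub_add_cancel] at h4
      rw [show t - (b + e) + n + (b + e) = t + n by ring] at h5
      rw [h5, h6, h4]
    · have h2 := hβ ⟨(t - (j + a + b + e)).toNat, by omega⟩
      simp only at h2
      rw [show j + a + ((t - (j + a + b + e)).toNat : ℕ) = t - (b + e) by omega,
        show j + a + n + b + ((t - (j + a + b + e)).toNat : ℕ) = t + n - e by omega] at h2
      have h4 := hcopy (t - (b + e)) (by omega) (by omega)
      have h5 := he (t + n - e) (by omega) (by omega)
      rw [sub_add_cancel] at h4 h5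
      rw [h5, ← h2, h4]
  · intro m hm hmn
    obtain ⟨t, ht, htj, hne⟩ := hfirst m hm hmn
    refine ⟨t + (b + e), by omega, by omega, ?_⟩
    rw [hcopy t (by omega) (by omega), show t + (b + e) + m = t + m + (b + e) by ring,
      hcopy (t + m) (by omega) (by omega)]
    exact hne

end Recurrence

/-! ### Shifts, cylinders and limits in both directions -/

open Filter Topology

/-- The two-sided word `y` shifted to the left by `m`. -/
def shift {A : Type*} (y : ℤ → A) (m : ℤ) : ℤ → A := fun t => y (t + m)

theorem shift_shift {A : Type*} (y : ℤ → A) (m n : ℤ) : shift (shift y n) m = shift y (n + m) := by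
  funext t
  simp only [shift]
  congr 1
  ring

/-- The words which agree with `y` on `[i, j)`. -/
def cylinder {A : Type*} (y : ℤ → A) (i j : ℤ) : Set (ℤ → A) :=
  {z | ∀ t, i ≤ t → t < j → z t = y t}

theorem IsDeepReturn.of_shift {A : Type*} {D : ℤ} {y z : ℤ → A} {i j n m : ℤ}
    (h : IsDeepReturn D z i j n)
    (hz : shift y m ∈ cylinder z (i - D) (j + D + n)) (hD : 0 < D) :
    IsDeepReturn D y (i + m) (j + m) n := by
  obtain ⟨h1, h2, h3, h4⟩ := h
  have hz : ∀ t, i - D ≤ t → t < j + D + n → y (t + m) = z t := hz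
  refine ⟨h1, by omega, fun t ht htj => ?_, fun l hl hln => ?_⟩
  · have e1 := hz (t - m) (by omega) (by omega)
    have e2 := hz (t - m + n) (by omega) (by omega)
    rw [sub_add_cancel] at e1
    rw [show t - m + n + m = t + n by ring] at e2
    rw [e1, e2, h3 _ (by omega) (by omega)]
  · obtain ⟨t, ht, htj, hne⟩ := h4 l hl hln
    refine ⟨t + m, by omega, by omega, ?_⟩
    rw [show t + m + l = t + l + m by ring, hz t (by omega) (by omega),
      hz (t + l) (by omega) (by omega)]
    exact hne

theorem exists_between_of_frequently {F : Filter ℤ} (hF : F = atTop ∨ F = atBot)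
    {P Q : ℤ → Prop} (hP : ∀ᶠ n in F, P n) (hQ : ∃ᶠ n in F, Q n) :
    ∃ a b, a < b ∧ Q a ∧ Q b ∧ ∀ n, a ≤ n → n ≤ b → P n := by
  rcases hF with rfl | rfl
  · obtain ⟨N, hN⟩ := eventually_atTop.1 hP
    obtain ⟨a, ha, hQa⟩ := frequently_atTop.1 hQ N
    obtain ⟨b, hb, hQb⟩ := frequently_atTop.1 hQ (a + 1)
    exact ⟨a, b, by omega, hQa, hQb, fun n _ _ => hN n (by omega)⟩
  · obtain ⟨N, hN⟩ := eventually_atBot.1 hP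
    obtain ⟨b, hb, hQb⟩ := frequently_atBot.1 hQ N
    obtain ⟨a, ha, hQa⟩ := frequently_atBot.1 hQ (b - 1)
    exact ⟨a, b, by omega, hQa, hQb, fun n _ _ => hN n (by omega)⟩

theorem exists_pair_of_frequently {F : Filter ℤ} (hF : F = atTop ∨ F = atBot)
    {P Q : ℤ → Prop} (hP : ∃ᶠ n in F, P n) (hQ : ∃ᶠ n in F, Q n) (B : ℤ) :
    ∃ m m', m' + B ≤ m ∧ P m ∧ Q m' := by
  rcases hF with rfl | rfl
  · obtain ⟨a, ha⟩ := hQ.exists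
    obtain ⟨b, hb, hPb⟩ := frequently_atTop.1 hP (a + B)
    exact ⟨b, a, hb, hPb, ha⟩
  · obtain ⟨a, ha⟩ := hP.exists
    obtain ⟨b, hb, hQb⟩ := frequently_atBot.1 hQ (a - B)
    exact ⟨a, b, by omega, ha, hQb⟩

theorem tendsto_add_of_atTop_or_atBot {F : Filter ℤ} (hF : F = atTop ∨ F = atBot) (m : ℤ) :
    Tendsto (fun n => n + m) F F := by
  rcases hF with rfl | rfl
  · exact tendsto_atTop_add_const_right _ m tendsto_id
  · exact tendsto_atBot_add_const_right _ m tendsto_id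

/-! ### Limit sets and splitting subshifts -/

section Subshifts

variable {A : Type*} [TopologicalSpace A] {D : ℤ} {F : Filter ℤ}

/-- The limit points of the shifts of `y` along `F`. -/
def limitSet (F : Filter ℤ) (y : ℤ → A) : Set (ℤ → A) :=
  {z | MapClusterPt z F (shift y)}

theorem isClosed_limitSet (F : Filter ℤ) (y : ℤ → A) : IsClosed (limitSet F y) :=
  isClosed_setOfPred_clusterPt

theorem continuous_shift (m : ℤ) : Continuous fun y : ℤ → A => shift y m :=
  continuous_pi fun t => continuous_apply (t + m)

theorem shift_mem_limitSet (hF : F = atTop ∨ F = atBot) {y z : ℤ → A} (hz : z ∈ limitSet F y)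
    (m : ℤ) : shift z m ∈ limitSet F y := by
  have h1 : MapClusterPt (shift z m) F ((fun y => shift y m) ∘ shift y) :=
    MapClusterPt.continuousAt_comp (continuous_shift m).continuousAt hz
  have h2 : ((fun y => shift y m) ∘ shift y) = shift y ∘ fun n => n + m := by
    funext n
    exact shift_shift y m n
  rw [h2] at h1
  exact h1.of_comp (tendsto_add_of_atTop_or_atBot hF m)

variable [DiscreteTopology A]

theorem isClopen_cylinder (y : ℤ → A) (i j : ℤ) : IsClopen (cylinder y i j) := by
  have : cylinder y i j = (Set.Ico i j).pi fun t => {y t} := by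
    ext z
    simp [cylinder, Set.mem_pi]
  rw [this]
  exact ⟨isClosed_set_pi fun _ _ => isClosed_discrete _,
    isOpen_set_pi (Set.finite_Ico i j) fun _ _ => isOpen_discrete _⟩

theorem frequently_mem_cylinder {y z : ℤ → A} (hz : z ∈ limitSet F y) (i j : ℤ) :
    ∃ᶠ n in F, shift y n ∈ cylinder z i j :=
  mapClusterPt_iff_frequently.1 hz _
    ((isClopen_cylinder z i j).isOpen.mem_nhds fun _ _ _ => rfl)

theorem isClosed_isMarker (D c : ℤ) : IsClosed {z : ℤ → A | IsMarker D z c} := by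
  rw [← isOpen_compl_iff, isOpen_iff_mem_nhds]
  intro z hz
  refine mem_of_superset ((isClopen_cylinder z c (c + 2 * D + 1)).isOpen.mem_nhds
    fun _ _ _ => rfl) fun w hw hwM => hz ?_
  exact IsMarker.congr hwM fun t h1 h2 => (hw t h1 (by omega)).symm

variable [Finite A]

/-- `Z` is a subshift in which some word has a marker, and each word with a marker which occurs in
`Z` extends in two ways by `D` letters on both sides. -/
structure IsSplitting (D : ℤ) (Z : Set (ℤ → A)) : Prop where
  isClosed : IsClosed Z
  shift_mem : ∀ z ∈ Z, ∀ m, shift z m ∈ Z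
  exists_marker : ∃ z ∈ Z, IsMarker D z 0
  split : ∀ z ∈ Z, ∀ i j, HasMarker D z i j →
    ∃ z' ∈ Z, z' ∈ cylinder z i j ∧ z' ∉ cylinder z (i - D) (j + D)

/-- If all limit points containing the marked word extended it alike, compactness would give this
for all its far occurrences in `y`. A first return between two of them would then be deep, its
length exceeding `D` by the marker. -/
theorem isSplitting_limitSet (hF : F = atTop ∨ F = atBot) (hD : 0 < D) {y : ℤ → A}
    (hy : ∀ᶠ i in F, ∀ j n, ¬ IsDeepReturn D y i j n) (hM : ∃ᶠ i in F, IsMarker D y i) :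
    IsSplitting D (limitSet F y) where
  isClosed := isClosed_limitSet F y
  shift_mem _ hz m := shift_mem_limitSet hF hz m
  exists_marker := by
    obtain ⟨z, hz, hcl⟩ := (isClosed_isMarker (A := A) D 0).isCompact
      |>.exists_mapClusterPt_of_frequently (l := F) (f := shift y) (hM.mono fun n hn => by
        have := hn.congr_shift (z := shift y n) (m := -n) fun t _ _ => by
          simp [shift]
        rwa [add_neg_cancel] at this)
    exact ⟨z, hcl, hz⟩
  split z hz i j hMz := by
    by_contra! hcon
    have hev : ∀ᶠ n in F, shift y n ∈ cylinder z i j → shift y n ∈ cylinder z (i - D) (j + D) := by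
      by_contra hne
      rw [not_eventually] at hne
      obtain ⟨z', hz', hcl⟩ :=
        (((isClopen_cylinder z i j).isClosed.inter
          (isClopen_cylinder z (i - D) (j + D)).compl.isClosed).isCompact
          ).exists_mapClusterPt_of_frequently (l := F) (f := shift y)
          (hne.mono fun n hn => by
            rw [Classical.not_imp] at hn
            exact hn)
      exact hz'.2 (hcon z' hcl hz'.1)
    -- The conditions are needed on all of `[a, b]`, as the first return `a + n` may come before
    -- `b`.
    obtain ⟨a, b, hab, ha, hb, hP⟩ := exists_between_of_frequently hF
      (hev.and ((tendsto_add_of_atTop_or_atBot hF i).eventually hy))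
      (frequently_mem_cylinder hz i j)
    have ha' : ∀ t, i ≤ t → t < j → y (t + a) = z t := ha
    have hb' : ∀ t, i ≤ t → t < j → y (t + b) = z t := hb
    obtain ⟨n, hn, hnb, hr, hf⟩ := exists_first_return (y := y) (i := i + a) (j := j + a)
      (m := b - a) (by omega) fun t ht htj => by
        have h1 := ha' (t - a) (by omega) (by omega)
        have h2 := hb' (t - a) (by omega) (by omega)
        rw [sub_add_cancel] at h1
        rw [h1, ← h2]
        congr 1
        ring
    have han : shift y (a + n) ∈ cylinder z i j := fun t ht htj => by
      rw [← ha' t ht htj, ← hr (t + a) (by omega) (by omega)]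
      simp only [shift]
      congr 1
      ring
    have h1 : ∀ t, i - D ≤ t → t < j + D → y (t + a) = z t := (hP a le_rfl hab.le).1 ha
    have h2 : ∀ t, i - D ≤ t → t < j + D → y (t + (a + n)) = z t :=
      (hP (a + n) (by omega) (by omega)).1 han
    obtain ⟨c, hc, hcj, hMc⟩ := hMz
    have hMa : IsMarker D y (c + a) := hMc.congr_shift fun t _ _ => ha' t (by omega) (by omega)
    rw [add_comm i a] at hr hf
    refine (hP a le_rfl hab.le).2 (j + a) n
      ⟨hMa.lt_return hn fun t _ _ => hr t (by omega) (by omega), by omega, ?_, ?_⟩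
    · intro t ht htj
      have e1 := h1 (t - a) (by omega) (by omega)
      have e2 := h2 (t - a) (by omega) (by omega)
      rw [sub_add_cancel] at e1
      rw [e1, ← e2]
      congr 1
      ring
    · intro m hm hmn
      obtain ⟨t, ht, htj, hne⟩ := hf m hm hmn
      exact ⟨t, ht, htj, hne⟩

theorem nonempty_sInter_inter {X : Type*} [TopologicalSpace X] [CompactSpace X] {c : Set (Set X)}
    (hc : IsChain (· ⊆ ·) c) (hne : c.Nonempty) (hcl : ∀ s ∈ c, IsClosed s) {K : Set X}
    (hK : IsClosed K) (h : ∀ s ∈ c, (s ∩ K).Nonempty) : (⋂₀ c ∩ K).Nonempty := by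
  have : Nonempty c := hne.to_subtype
  obtain ⟨z, hz⟩ := IsCompact.nonempty_iInter_of_directed_nonempty_isCompact_isClosed
    (fun s : c => s.1 ∩ K) (fun s s' => by
      rcases hc.total s.2 s'.2 with h1 | h1
      · exact ⟨s, Set.Subset.rfl, Set.inter_subset_inter_left _ h1⟩
      · exact ⟨s', Set.inter_subset_inter_left _ h1, Set.Subset.rfl⟩)
    (fun s => h s.1 s.2) (fun s => ((hcl s.1 s.2).inter hK).isCompact)
    (fun s => (hcl s.1 s.2).inter hK)
  rw [Set.mem_iInter] at hz
  obtain ⟨s, hs⟩ := hne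
  exact ⟨z, fun s hs => (hz ⟨s, hs⟩).1, (hz ⟨s, hs⟩).2⟩

/-- Each existence clause says that the subshift meets a fixed closed set, which passes to
intersections of chains by compactness. -/
theorem IsSplitting.sInter {c : Set (Set (ℤ → A))} (hc : IsChain (· ⊆ ·) c) (hne : c.Nonempty)
    (h : ∀ Z ∈ c, IsSplitting D Z) : IsSplitting D (⋂₀ c) where
  isClosed := isClosed_sInter fun Z hZ => (h Z hZ).isClosed
  shift_mem z hz m Z hZ := (h Z hZ).shift_mem z (hz Z hZ) m
  exists_marker := nonempty_sInter_inter hc hne (fun Z hZ => (h Z hZ).isClosed)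
    (isClosed_isMarker D 0) fun Z hZ => (h Z hZ).exists_marker
  split z hz i j hM := by
    obtain ⟨z', h1, h2⟩ := nonempty_sInter_inter hc hne (fun Z hZ => (h Z hZ).isClosed)
      ((isClopen_cylinder z i j).isClosed.inter
        (isClopen_cylinder z (i - D) (j + D)).compl.isClosed)
      fun Z hZ => (h Z hZ).split z (hz Z hZ) i j hM
    exact ⟨z', h1, h2⟩

theorem IsSplitting.exists_minimal {Z₀ : Set (ℤ → A)} (h : IsSplitting D Z₀) :
    ∃ Z ⊆ Z₀, Minimal (IsSplitting D) Z := by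
  obtain ⟨Z, hZ, hmin⟩ := zorn_superset_nonempty {Z : Set (ℤ → A) | IsSplitting D Z}
    (fun c hcs hc hne =>
      ⟨⋂₀ c, IsSplitting.sInter hc hne hcs, fun s hs => Set.sInter_subset_of_mem hs⟩)
    Z₀ h
  exact ⟨Z, hZ, hmin⟩

end Subshifts

/-! ### Infinitely many markers, and minimality -/

section Subshifts

variable {A : Type*} [TopologicalSpace A] {D : ℤ}

/-- Starting from a word with a marker in a splitting subshift, one finds another which agrees with
it on a given window and has a marker outside of that window. -/
theorem IsSplitting.exists_marker_outside {Z : Set (ℤ → A)} (h : IsSplitting D Z) (hD : 0 < D)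
    {z : ℤ → A} (hz : z ∈ Z) {N : ℕ} (hM : HasMarker D z (-N) N) :
    ∃ z' ∈ Z, ∃ N' : ℕ, N < N' ∧ z' ∈ cylinder z (-N) N ∧
      ∃ c : ℤ, -N' ≤ c ∧ c + 2 * D < N' ∧ (c < -N ∨ N ≤ c + 2 * D) ∧ IsMarker D z' c := by
  suffices ∃ z' ∈ Z, z' ∈ cylinder z (-N) N ∧
      ∃ c : ℤ, (c < -N ∨ N ≤ c + 2 * D) ∧ IsMarker D z' c by
    obtain ⟨z', hz', hcyl, c, hc, hMc⟩ := this
    exact ⟨z', hz', N + 1 + c.natAbs + (c + 2 * D).natAbs, by omega, hcyl, c, by omega, by omega,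
      hc, hMc⟩
  by_contra! hcon
  obtain ⟨z', hz', hcyl, hne⟩ := h.split z hz _ _ hM
  obtain ⟨c, hc, hcN, -⟩ := hM
  -- Without markers outside the window, its content determines the whole word, so there would be no
  -- splitting.
  refine hne fun t _ _ => congrFun (eq_of_not_isMarker hD (a := -N) (b := N) (by omega)
    (hcon z hz fun _ _ _ => rfl) (hcon z' hz' hcyl) hcyl) t

/-- Iterating `exists_marker_outside` gives words agreeing on growing windows; their pointwise limit
keeps every marker found. -/
theorem IsSplitting.exists_infinite_markers {Z : Set (ℤ → A)} (h : IsSplitting D Z) (hD : 0 < D) :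
    ∃ z ∈ Z, {c | IsMarker D z c}.Infinite := by
  let X := {q : (ℤ → A) × ℕ // q.1 ∈ Z ∧ HasMarker D q.1 (-q.2) q.2}
  have step : ∀ q : X, ∃ q' : X, q.1.2 < q'.1.2 ∧ q'.1.1 ∈ cylinder q.1.1 (-q.1.2) q.1.2 ∧
      ∃ c : ℤ, -q'.1.2 ≤ c ∧ c + 2 * D < q'.1.2 ∧ (c < -q.1.2 ∨ q.1.2 ≤ c + 2 * D) ∧
        IsMarker D q'.1.1 c := by
    rintro ⟨⟨z, N⟩, hz, hM⟩
    obtain ⟨z', hz', N', hN, hcyl, c, hc, hcN, hout, hMc⟩ := h.exists_marker_outside hD hz hM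
    exact ⟨⟨⟨z', N'⟩, hz', c, hc, hcN, hMc⟩, hN, hcyl, c, hc, hcN, hout, hMc⟩
  choose next hlt hcyl c hc hcN hout hMc using step
  obtain ⟨z₀, hz₀, hM₀⟩ := h.exists_marker
  let q₀ : X := ⟨⟨z₀, (2 * D + 1).toNat⟩, hz₀, 0, by simp, by dsimp only; omega, hM₀⟩
  let f : ℕ → X := fun n => next^[n] q₀
  have hf : ∀ n, f (n + 1) = next (f n) := fun n => Function.iterate_succ_apply' next n q₀
  have hmono : StrictMono fun n => (f n).1.2 := strictMono_nat_of_lt_succ fun n => by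
    rw [hf]
    exact hlt _
  have hagree : ∀ m k, (f (m + k)).1.1 ∈ cylinder (f m).1.1 (-(f m).1.2) (f m).1.2 := by
    intro m k
    induction k with
    | zero => exact fun _ _ _ => rfl
    | succ k ih =>
      intro t ht htN
      have hle : (f m).1.2 ≤ (f (m + k)).1.2 := hmono.monotone (by omega)
      rw [← ih t ht htN, ← add_assoc, hf]
      exact hcyl _ t (by omega) (by omega)
  -- The radii increase strictly, so the window at stage `t.natAbs + 1` contains `t`.
  let z : ℤ → A := fun t => (f (t.natAbs + 1)).1.1 t
  have hz : ∀ m, z ∈ cylinder (f m).1.1 (-(f m).1.2) (f m).1.2 := by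
    intro m t ht htN
    rcases le_total m (t.natAbs + 1) with h1 | h1
    · obtain ⟨k, hk⟩ := Nat.exists_eq_add_of_le h1
      change (f (t.natAbs + 1)).1.1 t = _
      rw [hk]
      exact hagree m k t ht htN
    · obtain ⟨k, hk⟩ := Nat.exists_eq_add_of_le h1
      have h2 : t.natAbs + 1 ≤ (f (t.natAbs + 1)).1.2 := hmono.id_le _
      rw [hk]
      exact (hagree _ k t (by omega) (by omega)).symm
  refine ⟨z, ?_, ?_⟩
  · refine h.isClosed.mem_of_tendsto (f := fun n => (f n).1.1) (b := atTop) ?_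
      (Eventually.of_forall fun n => (f n).2.1)
    refine tendsto_pi_nhds.2 fun t => tendsto_const_nhds.congr' ?_
    filter_upwards [eventually_ge_atTop (t.natAbs + 1)] with n hn
    have h2 : n ≤ (f n).1.2 := hmono.id_le _
    exact hz n t (by omega) (by omega)
  · have hinj : Function.Injective fun n => c (f n) := by
      have aux : ∀ m n, m < n → c (f m) ≠ c (f n) := by
        intro m n hmn heq
        have h1 := hc (f m)
        have h2 := hcN (f m)
        have h3 := hout (f n)
        rw [← hf] at h1 h2
        have h4 : (f (m + 1)).1.2 ≤ (f n).1.2 := hmono.monotone hmn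
        omega
      intro m n heq
      rcases lt_trichotomy m n with h1 | h1 | h1
      · exact absurd heq (aux m n h1)
      · exact h1
      · exact absurd heq.symm (aux n m h1)
    refine Set.infinite_of_injective_forall_mem hinj fun n => ?_
    have h1 := hc (f n)
    have h2 := hcN (f n)
    have h3 := hMc (f n)
    rw [← hf] at h1 h2 h3
    exact h3.congr fun t _ _ => hz (n + 1) t (by omega) (by omega)

theorem frequently_atTop_or_atBot_of_infinite {s : Set ℤ} (hs : s.Infinite) :
    ∃ F : Filter ℤ, (F = atTop ∨ F = atBot) ∧ ∃ᶠ n in F, n ∈ s := by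
  by_contra! hcon
  obtain ⟨a, ha⟩ := eventually_atTop.1 (hcon atTop (Or.inl rfl))
  obtain ⟨b, hb⟩ := eventually_atBot.1 (hcon atBot (Or.inr rfl))
  refine hs ((Set.finite_Icc b a).subset fun n hn => ⟨?_, ?_⟩)
  · by_contra! hlt
    exact hb n hlt.le hn
  · by_contra! hlt
    exact ha n hlt.le hn

variable [DiscreteTopology A] [Finite A]

/-- A splitting subshift contains a word with a deep return. -/
theorem IsSplitting.exists_isDeepReturn {l : ℕ} (hl : 0 < l) {Z : Set (ℤ → A)}
    (h : IsSplitting l Z) : ∃ z ∈ Z, ∃ i j n, IsDeepReturn l z i j n := by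
  by_contra! hcon
  obtain ⟨Y, hYZ, hY, hmin⟩ := h.exists_minimal
  obtain ⟨y, hyY, hinf⟩ := hY.exists_infinite_markers (by omega)
  obtain ⟨F, hF, hfreq⟩ := frequently_atTop_or_atBot_of_infinite hinf
  have hsub : limitSet F y ⊆ Y := fun z hz =>
    hY.isClosed.closure_subset <| mem_closure_iff_nhds.2 fun U hU => by
      obtain ⟨n, hn⟩ := (mapClusterPt_iff_frequently.1 hz U hU).exists
      exact ⟨_, hn, hY.shift_mem y hyY n⟩
  have hlim : IsSplitting l (limitSet F y) := isSplitting_limitSet hF (by omega)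
    (Eventually.of_forall fun i j n => hcon y (hYZ hyY) i j n) hfreq
  -- Minimality makes the limit set all of `Y`, so `y` is recurrent along `F`.
  have hy : y ∈ limitSet F y := hmin hlim hsub hyY
  obtain ⟨i, j, n, hret⟩ := exists_isDeepReturn_of_recurrent (l := l) (y := y)
    (fun i j i' j' B => exists_pair_of_frequently hF (frequently_mem_cylinder hy i j)
      (frequently_mem_cylinder hy i' j') B) hfreq.exists
  exact hcon y (hYZ hyY) i j n hret

end Subshifts

theorem isUltimatelyPeriodic_of_not_isDeepReturn {A : Type*} [Finite A] {x : Stream' A} {l : ℕ}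
    (hl : 0 < l) (h : ∀ i j n, (l : ℤ) ≤ i → ¬ IsDeepReturn l (twoSided x) i j n) :
    IsUltimatelyPeriodic x := by
  let _ : TopologicalSpace A := ⊥
  have : DiscreteTopology A := ⟨rfl⟩
  by_contra hx
  have hlim : IsSplitting l (limitSet atTop (twoSided x)) :=
    isSplitting_limitSet (Or.inl rfl) (by omega)
      ((eventually_ge_atTop (l : ℤ)).mono fun i hi j n => h i j n hi)
      (frequently_atTop.2 fun T => exists_isMarker_of_not_isUltimatelyPeriodic hx l T)
  obtain ⟨z, hz, i, j, n, hret⟩ := hlim.exists_isDeepReturn hl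
  -- The bound `l - i` places the copied return at a position `i + m ≥ l`, where `h` applies.
  obtain ⟨m, hm, hmc⟩ := ((frequently_mem_cylinder hz (i - l) (j + l + n)).and_eventually
    (eventually_ge_atTop (l - i))).exists
  exact h _ _ _ (by omega) (hret.of_shift hm (by omega))

end InfiniteWord

theorem theorem4p1 {A : Type*} [Finite A] (x : Stream' A) (S : Set ℕ)
    (hS : InfiniteWord.IsSyndetic S) (k : ℕ)
    (hk : ∀ n ∈ S, InfiniteWord.closedComplexity x n < k) :
    InfiniteWord.IsUltimatelyPeriodic x := by
  obtain ⟨d, hd, hS⟩ := hS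
  exact InfiniteWord.isUltimatelyPeriodic_of_not_isDeepReturn (l := k + d) (by omega)
    fun i j n hi => InfiniteWord.not_isDeepReturn_of_syndetic hS hk hi
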